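/- Let $T$ be a closed nondegenerate triangle $ABC$ in the Euclidean plane, let $$V(P)=\iint_T \frac{d\lambda(Q)}{|PQ|}$$ be the electrostatic potential of $T$ ($\lambda$ being the area measure), and let $\vec E=-\nabla V$ be its electrostatic field. If $P$ is a point in the interior of $T$ such that $\vec E(P)=\vec 0$, then $$\left(\frac{r_B+r_C-a}{r_B+r_C+a}\right)^{1/a}=\left(\frac{r_C+r_A-b}{r_C+r_A+b}\right)^{1/b}=\left(\frac{r_A+r_B-c}{r_A+r_B+c}\right)^{1/c}$$ and $$\left(\tan\frac{\beta_1}{2}\tan\frac{\gamma_2}{2}\right)^{1/\sin\alpha}=\left(\tan\frac{\gamma_1}{2}\tan\frac{\alpha_2}{2}\right)^{1/\sin\beta}=\left(\tan\frac{\alpha_1}{2}\tan\frac{\beta_2}{2}\right)^{1/\sin\gamma}.$$ Here $r_A=|PA|$, $r_B=|PB|$, $r_C=|PC|$; $a=|BC|$, $b=|CA|$, $c=|AB|$; $\alpha=\angle BAC$, $\beta=\angle CBA$, $\gamma=\angle ACB$; and $\alpha_1=\angle BAP$, $\alpha_2=\angle PAC$, $\beta_1=\angle CBP$, $\beta_2=\angle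 PBA$, $\gamma_1=\angle ACP$, $\gamma_2=\angle PCB$. -/

import Mathlib

open MeasureTheory EuclideanGeometry

/-- The Euclidean plane, with its Euclidean distance and Lebesgue (area) measure `volume`. -/
abbrev Plane : Type := EuclideanSpace ℝ (Fin 2)

/-- The closed solid triangle with vertices `A`, `B`, `C`. -/
def solidTriangle (A B C : Plane) : Set Plane := convexHull ℝ {A, B, C}

/-- The electrostatic potential at `P` of the homogeneously charged triangle `ABC`:
the area integral over the triangle of `1 / |PQ|`. -/
noncomputable def potential (A B C P : Plane) : ℝ :=
  ∫ Q in solidTriangle A B C, 1 / dist P Q ∂volume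

/-- The electrostatic field at `P` of the homogeneously charged triangle `ABC`:
minus the gradient of the potential. -/
noncomputable def field (A B C P : Plane) : Plane :=
  -gradient (potential A B C) P

/-!
For `P` inside the triangle, cut the triangle into `PBC`, `PCA` and `PAB`. In each piece,
parametrize by rays from `P`: the Jacobian `s D`, where `D` is twice the area of `PBC`, cancels
the singularity of `1 / |PQ|`, so that the piece contributes `D K` (`setIntegral_openTriangle`),
where `K = log ((r_B + r_C + a) / (r_B + r_C - a)) / a` is the mean value of `1 / |PQ|` over the
side `BC` (`integral_inv_dist_segment`). Hence `V` is, near `P`, an explicit sum of three such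
products (`potential_eq`).

When the product `D K` is differentiated, the part `D ∇K` is a difference of two unit vectors,
along `BP` and `CP`, turned by a right angle (`hasFDerivAt_signedArea_mul_sidePotential`). These
parts cancel in the cyclic sum, and `∇D` is the side `BC` turned by a right angle. So `V` is
differentiable at `P`, and a zero of the field is a linear relation between the three sides with
coefficients `K`. The only such relation is the closing condition of the triangle, so the three
values of `K` agree (`sidePotential_eq_of_field_eq_zero`).

The first chain of equalities is the exponential of this one. The second is the first, rewritten
by the half-angle formula `tan (β₁ / 2) tan (γ₂ / 2) = (r_B + r_C - a) / (r_B + r_C + a)` and the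
law of sines (`equalities_of_sidePotential_eq`).
-/

/-! ### Areas, distances and half-angles -/

/-- Twice the signed area of the triangle `PBC`, positive when the vertices are listed
counterclockwise. -/
def signedArea (P B C : Plane) : ℝ :=
  (B 0 - P 0) * (C 1 - P 1) - (B 1 - P 1) * (C 0 - P 0)

/-- The quotient `(|PB| + |PC| - |BC|) / (|PB| + |PC| + |BC|)`. -/
noncomputable def sideRatio (P B C : Plane) : ℝ :=
  (dist P B + dist P C - dist B C) / (dist P B + dist P C + dist B C)

/-- The mean value over the side `BC` of `1 / |PQ|`, in closed form
(see `integral_inv_dist_segment`). -/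
noncomputable def sidePotential (P B C : Plane) : ℝ :=
  -Real.log (sideRatio P B C) / dist B C

theorem signedArea_rotate (P B C : Plane) : signedArea P B C = signedArea B C P := by
  unfold signedArea; ring

theorem signedArea_swap (P B C : Plane) : signedArea P C B = -signedArea P B C := by
  unfold signedArea; ring

theorem dist_sq_eq (P Q : Plane) : dist P Q ^ 2 = (P 0 - Q 0) ^ 2 + (P 1 - Q 1) ^ 2 := by
  rw [EuclideanSpace.dist_eq, Real.sq_sqrt (by positivity)]
  simp [Real.dist_eq]

theorem dist_pos_of_signedArea_ne_zero {P B C : Plane} (h : signedArea P B C ≠ 0) :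
    0 < dist P B := by
  refine dist_pos.2 ?_
  rintro rfl
  simp [signedArea] at h

/-- Lagrange's identity makes the Cauchy-Schwarz inequality strict for noncollinear points. -/
theorem dist_mul_dist_add_inner_pos {P B C : Plane} (h : signedArea P B C ≠ 0) :
    0 < dist P B * dist P C +
      ((P 0 - B 0) * (P 0 - C 0) + (P 1 - B 1) * (P 1 - C 1)) := by
  have h1 := dist_sq_eq P B
  have h2 := dist_sq_eq P C
  have h3 : 0 < signedArea P B C ^ 2 := by positivity
  have h4 : (dist P B * dist P C) ^ 2 = signedArea P B C ^ 2 +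
      ((P 0 - B 0) * (P 0 - C 0) + (P 1 - B 1) * (P 1 - C 1)) ^ 2 := by
    rw [mul_pow, h1, h2, signedArea]; ring
  have h5 := abs_lt_of_sq_lt_sq (by rw [h4]; linarith) (by positivity :
    0 ≤ dist P B * dist P C) (a := (P 0 - B 0) * (P 0 - C 0) + (P 1 - B 1) * (P 1 - C 1))
  linarith [(abs_lt.1 h5).1]

theorem dist_add_sq_sub (P B C : Plane) :
    (dist P B + dist P C) ^ 2 - dist B C ^ 2 = 2 * (dist P B * dist P C +
      ((P 0 - B 0) * (P 0 - C 0) + (P 1 - B 1) * (P 1 - C 1))) := by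
  have h1 := dist_sq_eq P B
  have h2 := dist_sq_eq P C
  have h3 := dist_sq_eq B C
  linear_combination h1 + h2 - h3

theorem dist_lt_dist_add_dist {P B C : Plane} (h : signedArea P B C ≠ 0) :
    dist B C < dist P B + dist P C := by
  have h1 := dist_mul_dist_add_inner_pos h
  have h2 := dist_add_sq_sub P B C
  exact lt_of_pow_lt_pow_left₀ 2 (by positivity) (by linarith)

theorem sideRatio_pos {P B C : Plane} (h : signedArea P B C ≠ 0) : 0 < sideRatio P B C := by
  have h1 := dist_lt_dist_add_dist h
  have h2 := dist_pos_of_signedArea_ne_zero h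
  unfold sideRatio
  have : 0 < dist P B + dist P C - dist B C := by linarith
  positivity

theorem sideRatio_comm (P B C : Plane) : sideRatio P B C = sideRatio P C B := by
  unfold sideRatio
  rw [dist_comm C B, add_comm (dist P C)]

theorem sidePotential_comm (P B C : Plane) : sidePotential P B C = sidePotential P C B := by
  unfold sidePotential
  rw [sideRatio_comm, dist_comm]

theorem tan_half_sq {x : ℝ} (hx : 1 + Real.cos x ≠ 0) :
    Real.tan (x / 2) ^ 2 * (1 + Real.cos x) = 1 - Real.cos x := by
  obtain ⟨y, rfl⟩ : ∃ y, x = 2 * y := ⟨x / 2, by ring⟩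
  rw [Real.cos_two_mul] at hx
  have h : Real.cos y ≠ 0 := by
    intro h
    simp [h] at hx
  rw [mul_div_cancel_left₀ _ two_ne_zero, Real.cos_two_mul, Real.tan_eq_sin_div_cos]
  field_simp
  linear_combination 2 * Real.cos y ^ 2 * Real.sin_sq_add_cos_sq y

theorem tan_half_angle_nonneg (A B C : Plane) : 0 ≤ Real.tan (∠ A B C / 2) := by
  refine Real.tan_nonneg_of_nonneg_of_le_pi_div_two ?_ ?_
  · linarith [angle_nonneg A B C]
  · linarith [angle_le_pi A B C]

/-- The half-angle formula for the square of `tan (β / 2)` in the triangle `PBC`, with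
denominators cleared. -/
theorem tan_half_angle_sq {C B P : Plane} (h : signedArea P B C ≠ 0) :
    Real.tan (∠ C B P / 2) ^ 2 * ((dist B C + dist P B) ^ 2 - dist P C ^ 2) =
      dist P C ^ 2 - (dist B C - dist P B) ^ 2 := by
  have h1 := law_cos C B P
  rw [dist_comm C P, dist_comm C B] at h1
  have h2 : Real.tan (∠ C B P / 2) ^ 2 * (1 + Real.cos (∠ C B P)) = 1 - Real.cos (∠ C B P) := by
    refine tan_half_sq fun h0 => ?_
    have h3 := dist_lt_dist_add_dist (signedArea_rotate P B C ▸ h)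
    rw [dist_comm C P, dist_comm B P] at h3
    have h4 : dist P C ^ 2 = (dist B C + dist P B) ^ 2 := by
      linear_combination h1 - 2 * dist B C * dist P B * h0
    exact h3.ne ((sq_eq_sq₀ dist_nonneg (by positivity)).1 h4)
  linear_combination 2 * dist B C * dist P B * h2 -
    (1 + Real.tan (∠ C B P / 2) ^ 2) * h1

/-- The half-angle formula `tan (β / 2) * tan (γ / 2) = (s - a) / s` in the triangle `PBC`
with semiperimeter `s`. -/
theorem tan_half_mul_tan_half {C B P : Plane} (h : signedArea P B C ≠ 0) :
    Real.tan (∠ C B P / 2) * Real.tan (∠ P C B / 2) = sideRatio P B C := by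
  have hA := dist_lt_dist_add_dist h
  have hB := dist_lt_dist_add_dist (signedArea_rotate P B C ▸ h)
  have hC := dist_lt_dist_add_dist ((signedArea_rotate P B C).trans
    (signedArea_rotate B C P) ▸ h)
  have h' : signedArea P C B ≠ 0 := by rw [signedArea_swap]; exact neg_ne_zero.2 h
  have e1 := tan_half_angle_sq h
  have e2 := tan_half_angle_sq h'
  rw [angle_comm B C P] at e2
  rw [dist_comm C B] at e2
  rw [dist_comm C P, dist_comm B P] at hB
  rw [dist_comm C P, dist_comm C B] at hC
  have p := dist_pos_of_signedArea_ne_zero h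
  have hr := sideRatio_pos h
  refine (sq_eq_sq₀ (mul_nonneg (tan_half_angle_nonneg _ _ _) (tan_half_angle_nonneg _ _ _))
    hr.le).1 ?_
  unfold sideRatio
  generalize Real.tan (∠ C B P / 2) = x at *
  generalize Real.tan (∠ P C B / 2) = y at *
  generalize dist P B = b at *
  generalize dist P C = c at *
  generalize dist B C = a at *
  have k1 : 0 < a + b - c := by linarith
  have k2 : 0 < a + c - b := by linarith
  have k3 : 0 < b + c + a := by linarith
  have f1 : x ^ 2 = (c + b - a) * (c + a - b) / ((a + b - c) * (b + c + a)) := by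
    rw [eq_div_iff (by positivity)]; linear_combination e1
  have f2 : y ^ 2 = (c + b - a) * (b + a - c) / ((a + c - b) * (b + c + a)) := by
    rw [eq_div_iff (by positivity)]; linear_combination e2
  rw [mul_pow, f1, f2]
  field_simp
  ring

theorem rpow_sideRatio {P B C : Plane} (h : signedArea P B C ≠ 0) (x : ℝ) :
    sideRatio P B C ^ x = Real.exp (-(sidePotential P B C * (dist B C * x))) := by
  have hd := dist_pos_of_signedArea_ne_zero (signedArea_rotate P B C ▸ h)
  rw [Real.rpow_def_of_pos (sideRatio_pos h), sidePotential]
  congr 1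
  field_simp

theorem signedArea_ne_zero {A B C : Plane} (h : AffineIndependent ℝ ![A, B, C]) :
    signedArea A B C ≠ 0 := by
  intro h0
  rw [affineIndependent_iff_not_collinear_set] at h
  apply h
  by_cases hAB : A = B
  · simpa [hAB] using collinear_pair ℝ B C
  have hd : 0 < dist A B ^ 2 := by have := dist_pos.2 hAB; positivity
  rw [dist_sq_eq] at hd
  rw [signedArea] at h0
  refine (collinear_iff_of_mem (p₀ := A) (by simp)).2 ⟨B - A, ?_⟩
  rintro p (rfl | rfl | rfl)
  · exact ⟨0, by simp⟩
  · exact ⟨1, by simp⟩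
  -- the coefficient of the orthogonal projection of `p - A` on the direction `B - A`
  · refine ⟨((p 0 - A 0) * (B 0 - A 0) + (p 1 - A 1) * (B 1 - A 1)) /
      ((A 0 - B 0) ^ 2 + (A 1 - B 1) ^ 2), ?_⟩
    ext i
    fin_cases i
    · simp
      field_simp
      linear_combination (-(B 1 - A 1)) * h0
    · simp
      field_simp
      linear_combination (B 0 - A 0) * h0

/-- The two chains of equalities say that the side potentials agree: the first by taking
logarithms, the second by the half-angle formula and the law of sines. -/
theorem equalities_of_sidePotential_eq {A B C P : Plane}
    (hABC : AffineIndependent ℝ ![A, B, C]) (hA : signedArea P B C ≠ 0)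
    (hB : signedArea P C A ≠ 0) (hC : signedArea P A B ≠ 0)
    (h1 : sidePotential P B C = sidePotential P C A)
    (h2 : sidePotential P C A = sidePotential P A B) :
    (sideRatio P B C ^ (1 / dist B C) = sideRatio P C A ^ (1 / dist C A) ∧
      sideRatio P C A ^ (1 / dist C A) = sideRatio P A B ^ (1 / dist A B)) ∧
    ((Real.tan (∠ C B P / 2) * Real.tan (∠ P C B / 2)) ^ (1 / Real.sin (∠ B A C))
        = (Real.tan (∠ A C P / 2) * Real.tan (∠ P A C / 2)) ^ (1 / Real.sin (∠ C B A)) ∧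
      (Real.tan (∠ A C P / 2) * Real.tan (∠ P A C / 2)) ^ (1 / Real.sin (∠ C B A))
        = (Real.tan (∠ B A P / 2) * Real.tan (∠ P B A / 2)) ^ (1 / Real.sin (∠ A C B))) := by
  have hcol := affineIndependent_iff_not_collinear_set.1 hABC
  have sA : Real.sin (∠ B A C) ≠ 0 := sin_ne_zero_of_not_collinear
    (by rwa [Set.insert_comm])
  have sB : Real.sin (∠ C B A) ≠ 0 := by
    rw [angle_comm]; exact sin_ne_zero_of_not_collinear hcol
  have sC : Real.sin (∠ A C B) ≠ 0 := sin_ne_zero_of_not_collinear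
    (by rwa [Set.pair_comm])
  have dA := (dist_pos_of_signedArea_ne_zero (signedArea_rotate P B C ▸ hA)).ne'
  have dB := (dist_pos_of_signedArea_ne_zero (signedArea_rotate P C A ▸ hB)).ne'
  have dC := (dist_pos_of_signedArea_ne_zero (signedArea_rotate P A B ▸ hC)).ne'
  have l1 : dist B C * (1 / Real.sin (∠ B A C)) = dist C A * (1 / Real.sin (∠ C B A)) := by
    have := law_sin B A C
    rw [dist_comm A C, dist_comm C B] at this
    field_simp
    linarith
  have l2 : dist C A * (1 / Real.sin (∠ C B A)) = dist A B * (1 / Real.sin (∠ A C B)) := by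
    have := law_sin C B A
    rw [dist_comm B A, dist_comm A C] at this
    field_simp
    linarith
  rw [tan_half_mul_tan_half hA, tan_half_mul_tan_half hB, tan_half_mul_tan_half hC]
  simp only [rpow_sideRatio hA, rpow_sideRatio hB, rpow_sideRatio hC, h1, h2, l1, l2,
    mul_one_div_cancel dA, mul_one_div_cancel dB, mul_one_div_cancel dC, and_self]

/-! ### The potential of a triangle at one of its vertices -/

/-- The identification of `ℝ × ℝ` with the plane by Cartesian coordinates. -/
def ofCoords (z : ℝ × ℝ) : Plane := !₂[z.1, z.2]

@[simp] theorem ofCoords_zero (z : ℝ × ℝ) : ofCoords z 0 = z.1 := rfl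

@[simp] theorem ofCoords_one (z : ℝ × ℝ) : ofCoords z 1 = z.2 := rfl

theorem measurePreserving_ofCoords : MeasurePreserving ofCoords :=
  (EuclideanSpace.volume_preserving_symm_measurableEquiv_toLp (Fin 2)).symm.comp
    (volume_preserving_finTwoArrow ℝ).symm

theorem measurableEmbedding_ofCoords : MeasurableEmbedding ofCoords :=
  (MeasurableEquiv.toLp 2 (Fin 2 → ℝ)).measurableEmbedding.comp
    (MeasurableEquiv.finTwoArrow (α := ℝ)).symm.measurableEmbedding

/-- The open triangle `PBC`, for vertices listed counterclockwise. -/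
def openTriangle (P B C : Plane) : Set Plane :=
  {Q | 0 < signedArea Q B C ∧ 0 < signedArea P Q C ∧ 0 < signedArea P B Q}

theorem continuous_signedArea {f g h : Plane → Plane} (hf : Continuous f) (hg : Continuous g)
    (hh : Continuous h) : Continuous fun Q => signedArea (f Q) (g Q) (h Q) := by
  unfold signedArea
  fun_prop

theorem isOpen_openTriangle (P B C : Plane) : IsOpen (openTriangle P B C) :=
  (isOpen_lt continuous_const
    (continuous_signedArea continuous_id continuous_const continuous_const)).inter
  ((isOpen_lt continuous_const
    (continuous_signedArea continuous_const continuous_id continuous_const)).inter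
  (isOpen_lt continuous_const
    (continuous_signedArea continuous_const continuous_const continuous_id)))

/-- The parametrization of the triangle `PBC` by the unit square, linear along each ray from
`P`: the point `(s, t)` is sent to `P + s ((1 - t) (B - P) + t (C - P))`. -/
def conePoint (P B C : Plane) (z : ℝ × ℝ) : ℝ × ℝ :=
  (P 0 + z.1 * ((1 - z.2) * (B 0 - P 0) + z.2 * (C 0 - P 0)),
   P 1 + z.1 * ((1 - z.2) * (B 1 - P 1) + z.2 * (C 1 - P 1)))

/-- The derivative of `conePoint`. -/
noncomputable def conePointDeriv (P B C : Plane) (z : ℝ × ℝ) : ℝ × ℝ →L[ℝ] ℝ × ℝ :=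
  (Matrix.toLin (.finTwoProd ℝ) (.finTwoProd ℝ)
    !![(1 - z.2) * (B 0 - P 0) + z.2 * (C 0 - P 0), z.1 * (C 0 - B 0);
       (1 - z.2) * (B 1 - P 1) + z.2 * (C 1 - P 1), z.1 * (C 1 - B 1)]).toContinuousLinearMap

theorem hasFDerivAt_conePoint (P B C : Plane) (z : ℝ × ℝ) :
    HasFDerivAt (conePoint P B C) (conePointDeriv P B C z) z := by
  unfold conePointDeriv
  rw [Matrix.toLin_finTwoProd_toContinuousLinearMap]
  have h (b c p : ℝ) : HasFDerivAt
      (fun z : ℝ × ℝ => p + z.1 * ((1 - z.2) * (b - p) + z.2 * (c - p)))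
      (((1 - z.2) * (b - p) + z.2 * (c - p)) • ContinuousLinearMap.fst ℝ ℝ ℝ +
        (z.1 * (c - b)) • ContinuousLinearMap.snd ℝ ℝ ℝ) z := by
    have h1 : HasFDerivAt (fun z : ℝ × ℝ => z.1) (ContinuousLinearMap.fst ℝ ℝ ℝ) z :=
      hasFDerivAt_fst
    have h2 : HasFDerivAt (fun z : ℝ × ℝ => z.2) (ContinuousLinearMap.snd ℝ ℝ ℝ) z :=
      hasFDerivAt_snd
    refine ((h1.mul (((h2.const_sub 1).mul_const (b - p)).add
      (h2.mul_const (c - p)))).const_add p).congr_fderiv ?_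
    ext
    · simp
    · simp; ring
  exact (h _ _ _).prodMk (h _ _ _)

theorem det_conePointDeriv (P B C : Plane) (z : ℝ × ℝ) :
    (conePointDeriv P B C z).det = z.1 * signedArea P B C := by
  simp only [conePointDeriv, ContinuousLinearMap.det, LinearMap.coe_toContinuousLinearMap,
    LinearMap.det_toLin, Matrix.det_fin_two_of, signedArea]
  ring

theorem signedArea_conePoint (P B C : Plane) (z : ℝ × ℝ) :
    signedArea (ofCoords (conePoint P B C z)) B C = (1 - z.1) * signedArea P B C ∧
    signedArea P (ofCoords (conePoint P B C z)) C = z.1 * (1 - z.2) * signedArea P B C ∧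
    signedArea P B (ofCoords (conePoint P B C z)) = z.1 * z.2 * signedArea P B C := by
  simp only [signedArea, ofCoords_zero, ofCoords_one, conePoint]
  exact ⟨by ring, by ring, by ring⟩

/-- The open unit square. -/
def unitSquare : Set (ℝ × ℝ) := Set.Ioo 0 1 ×ˢ Set.Ioo 0 1

theorem injOn_conePoint {P B C : Plane} (h : 0 < signedArea P B C) :
    Set.InjOn (conePoint P B C) unitSquare := by
  intro z hz w hw hzw
  obtain ⟨h1, -, h3⟩ := signedArea_conePoint P B C z
  obtain ⟨k1, -, k3⟩ := signedArea_conePoint P B C w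
  rw [hzw, k1] at h1
  rw [hzw, k3] at h3
  have e1 : z.1 = w.1 := by linarith [mul_right_cancel₀ h.ne' h1]
  have e2 := mul_right_cancel₀ h.ne' h3
  rw [e1] at e2
  exact Prod.ext e1 (mul_left_cancel₀ hw.1.1.ne' e2).symm

theorem image_conePoint {P B C : Plane} (h : 0 < signedArea P B C) :
    conePoint P B C '' unitSquare = ofCoords ⁻¹' openTriangle P B C := by
  ext q
  constructor
  · rintro ⟨z, ⟨⟨z1, z2⟩, z3, z4⟩, rfl⟩
    obtain ⟨h1, h2, h3⟩ := signedArea_conePoint P B C z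
    refine ⟨?_, ?_, ?_⟩
    · rw [h1]; exact mul_pos (by linarith) h
    · rw [h2]; exact mul_pos (mul_pos z1 (by linarith)) h
    · rw [h3]; exact mul_pos (mul_pos z1 z3) h
  · rintro ⟨h1, h2, h3⟩
    set x := signedArea P (ofCoords q) C with hx
    set y := signedArea P B (ofCoords q) with hy
    have hsum : signedArea (ofCoords q) B C + x + y = signedArea P B C := by
      simp only [hx, hy, signedArea]; ring
    have hxy : 0 < x + y := add_pos h2 h3
    refine ⟨((x + y) / signedArea P B C, y / (x + y)), ⟨⟨by positivity, ?_⟩, by positivity, ?_⟩, ?_⟩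
    · rw [div_lt_one h]; linarith
    · rw [div_lt_one hxy]; linarith
    · have e1 : (x + y) / signedArea P B C * (y / (x + y)) = y / signedArea P B C := by
        field_simp
      have e2 : (x + y) / signedArea P B C * (1 - y / (x + y)) = x / signedArea P B C := by
        field_simp; ring
      have key (p b c : ℝ) : (x + y) / signedArea P B C * ((1 - y / (x + y)) * (b - p) +
          y / (x + y) * (c - p)) = (x * (b - p) + y * (c - p)) / signedArea P B C := by
        linear_combination (b - p) * e2 + (c - p) * e1
      simp only [conePoint, key]
      refine Prod.ext ?_ ?_
      all_goals
        simp only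
        rw [← eq_sub_iff_add_eq', div_eq_iff h.ne']
        simp only [hx, hy, signedArea, ofCoords_zero, ofCoords_one]
        ring

/-- The distance from `P` to the point dividing the segment `BC` in the ratio `t : (1 - t)`. -/
noncomputable def segmentDist (P B C : Plane) (t : ℝ) : ℝ :=
  √(((1 - t) * (B 0 - P 0) + t * (C 0 - P 0)) ^ 2 + ((1 - t) * (B 1 - P 1) + t * (C 1 - P 1)) ^ 2)

theorem segmentDist_arg_pos {P B C : Plane} (h : signedArea P B C ≠ 0) (t : ℝ) :
    0 < ((1 - t) * (B 0 - P 0) + t * (C 0 - P 0)) ^ 2 +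
      ((1 - t) * (B 1 - P 1) + t * (C 1 - P 1)) ^ 2 := by
  by_contra! hn
  have h1 : (1 - t) * (B 0 - P 0) + t * (C 0 - P 0) = 0 := by
    nlinarith [sq_nonneg ((1 - t) * (B 0 - P 0) + t * (C 0 - P 0)),
      sq_nonneg ((1 - t) * (B 1 - P 1) + t * (C 1 - P 1))]
  have h2 : (1 - t) * (B 1 - P 1) + t * (C 1 - P 1) = 0 := by
    nlinarith [sq_nonneg ((1 - t) * (B 0 - P 0) + t * (C 0 - P 0)),
      sq_nonneg ((1 - t) * (B 1 - P 1) + t * (C 1 - P 1))]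
  apply h
  unfold signedArea
  linear_combination (C 1 - B 1) * h1 - (C 0 - B 0) * h2

theorem continuous_inv_segmentDist {P B C : Plane} (h : signedArea P B C ≠ 0) :
    Continuous fun t => 1 / segmentDist P B C t := by
  refine continuous_const.div ?_ fun t => (Real.sqrt_pos.2 (segmentDist_arg_pos h t)).ne'
  unfold segmentDist
  fun_prop

/-- The mean value of `1 / |PQ|` over the segment `BC`. With `r` the distance from `P` to the
moving point, an antiderivative is `log (a r + ⟪Q - P, C - B⟫) / a`, where `a = |BC|`. -/
theorem integral_inv_dist_segment {P B C : Plane} (h : signedArea P B C ≠ 0) :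
    ∫ t in (0 : ℝ)..1, 1 / segmentDist P B C t = sidePotential P B C := by
  have ha := dist_pos_of_signedArea_ne_zero (signedArea_rotate P B C ▸ h)
  have ha2 := dist_sq_eq B C
  have hb2 := dist_sq_eq P B
  have hc2 := dist_sq_eq P C
  set a := dist B C
  let q (t : ℝ) : ℝ := ((1 - t) * (B 0 - P 0) + t * (C 0 - P 0)) * (C 0 - B 0) +
    ((1 - t) * (B 1 - P 1) + t * (C 1 - P 1)) * (C 1 - B 1)
  have hr (t : ℝ) : 0 < segmentDist P B C t := Real.sqrt_pos.2 (segmentDist_arg_pos h t)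
  have hr2 (t : ℝ) : segmentDist P B C t ^ 2 = _ := Real.sq_sqrt (segmentDist_arg_pos h t).le
  have hpos (t : ℝ) : 0 < a * segmentDist P B C t + q t := by
    have h3 : 0 < signedArea P B C ^ 2 := by positivity
    have h4 : (a * segmentDist P B C t) ^ 2 = signedArea P B C ^ 2 + q t ^ 2 := by
      rw [mul_pow, hr2, ha2, signedArea]; ring
    have h5 := abs_lt_of_sq_lt_sq (by rw [h4]; linarith)
      (mul_pos ha (hr t)).le (a := q t)
    linarith [(abs_lt.1 h5).1]
  have hderiv (t : ℝ) : HasDerivAt (fun t => Real.log (a * segmentDist P B C t + q t) / a)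
      (1 / segmentDist P B C t) t := by
    have l (p b c : ℝ) : HasDerivAt (fun t : ℝ => (1 - t) * (b - p) + t * (c - p)) (c - b) t := by
      refine ((((hasDerivAt_id t).const_sub 1).mul_const (b - p)).add
        ((hasDerivAt_id t).mul_const (c - p))).congr_deriv ?_
      ring
    have d1 : HasDerivAt (segmentDist P B C) (q t / segmentDist P B C t) t := by
      refine ((((l (P 0) (B 0) (C 0)).pow 2).add ((l (P 1) (B 1) (C 1)).pow 2)).sqrt
        (segmentDist_arg_pos h t).ne').congr_deriv ?_
      change _ / (2 * segmentDist P B C t) = _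
      have := hr t
      simp only [q]
      field_simp
      norm_num
    have d2 : HasDerivAt q (a ^ 2) t := by
      refine (((l (P 0) (B 0) (C 0)).mul_const _).add
        ((l (P 1) (B 1) (C 1)).mul_const _)).congr_deriv ?_
      rw [ha2]; ring
    refine ((((d1.const_mul a).add d2).log (hpos t).ne').div_const a).congr_deriv ?_
    have := hr t
    have := hpos t
    change (a * (q t / segmentDist P B C t) + a ^ 2) / (a * segmentDist P B C t + q t) / a = _
    field_simp
    ring
  rw [intervalIntegral.integral_eq_sub_of_hasDerivAt (fun t _ => hderiv t)
    ((continuous_inv_segmentDist h).intervalIntegrable 0 1)]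
  have r0 : segmentDist P B C 0 = dist P B := by
    rw [← Real.sqrt_sq (dist_nonneg (x := P) (y := B)), hb2, segmentDist]
    congr 1; ring
  have r1 : segmentDist P B C 1 = dist P C := by
    rw [← Real.sqrt_sq (dist_nonneg (x := P) (y := C)), hc2, segmentDist]
    congr 1; ring
  have p0 := hpos 0
  have p1 := hpos 1
  rw [← sub_div, ← Real.log_div p1.ne' p0.ne', sidePotential, ← Real.log_inv]
  rw [r0] at p0 ⊢
  rw [r1] at p1 ⊢
  have hs : 0 < dist P B + dist P C - a := by linarith [dist_lt_dist_add_dist h]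
  have hs' : 0 < dist P B + dist P C + a := by linarith
  congr 2
  rw [sideRatio, inv_div, div_eq_div_iff p0.ne' hs.ne']
  -- `2 q 0` and `2 q 1` in terms of the sides
  have q0 : 2 * q 0 = dist P C ^ 2 - dist P B ^ 2 - a ^ 2 := by
    rw [ha2, hb2, hc2]; simp only [q]; ring
  have q1 : 2 * q 1 = dist P C ^ 2 - dist P B ^ 2 + a ^ 2 := by
    rw [ha2, hb2, hc2]; simp only [q]; ring
  linear_combination (1 / 2) * (dist P B + dist P C - a) * q1 -
    (1 / 2) * (dist P B + dist P C + a) * q0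

theorem dist_conePoint {P B C : Plane} {z : ℝ × ℝ} (hz : 0 < z.1) :
    dist P (ofCoords (conePoint P B C z)) = z.1 * segmentDist P B C z.2 := by
  have hr : 0 ≤ segmentDist P B C z.2 := Real.sqrt_nonneg _
  refine (sq_eq_sq₀ dist_nonneg (by positivity)).1 ?_
  rw [dist_sq_eq, mul_pow, segmentDist, Real.sq_sqrt (by positivity)]
  simp only [ofCoords_zero, ofCoords_one, conePoint]
  ring

/-- The Jacobian of `conePoint` cancels the singularity of `1 / |PQ|` at `P`. -/
theorem abs_det_mul_inv_dist {P B C : Plane} (h : 0 < signedArea P B C) {z : ℝ × ℝ}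
    (hz : z ∈ unitSquare) :
    |(conePointDeriv P B C z).det| • (1 / dist P (ofCoords (conePoint P B C z))) =
      signedArea P B C * (1 / segmentDist P B C z.2) := by
  have hz1 : 0 < z.1 := hz.1.1
  have hr : 0 < segmentDist P B C z.2 := Real.sqrt_pos.2 (segmentDist_arg_pos h.ne' z.2)
  rw [det_conePointDeriv, dist_conePoint hz1, abs_of_pos (mul_pos hz1 h), smul_eq_mul]
  field_simp

theorem measurableSet_unitSquare : MeasurableSet unitSquare :=
  measurableSet_Ioo.prod measurableSet_Ioo

theorem integrableOn_openTriangle {P B C : Plane} (h : 0 < signedArea P B C) :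
    IntegrableOn (fun Q => 1 / dist P Q) (openTriangle P B C) := by
  rw [← measurePreserving_ofCoords.integrableOn_comp_preimage measurableEmbedding_ofCoords,
    ← image_conePoint h, integrableOn_image_iff_integrableOn_abs_det_fderiv_smul volume
      measurableSet_unitSquare (fun z _ => (hasFDerivAt_conePoint P B C z).hasFDerivWithinAt)
      (injOn_conePoint h)]
  simp only [Function.comp_apply]
  rw [integrableOn_congr_fun (fun z hz => abs_det_mul_inv_dist h hz) measurableSet_unitSquare]
  rw [IntegrableOn, unitSquare, Measure.volume_eq_prod, ← Measure.prod_restrict]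
  refine Integrable.mul_prod (f := fun _ : ℝ => signedArea P B C)
    (g := fun t => 1 / segmentDist P B C t) (integrable_const _) ?_
  exact ((continuous_inv_segmentDist h.ne').integrableOn_Icc (a := 0) (b := 1)).mono_set
    Set.Ioo_subset_Icc_self

theorem setIntegral_openTriangle {P B C : Plane} (h : 0 < signedArea P B C) :
    ∫ Q in openTriangle P B C, 1 / dist P Q = signedArea P B C * sidePotential P B C := by
  rw [← measurePreserving_ofCoords.setIntegral_preimage_emb measurableEmbedding_ofCoords,
    ← image_conePoint h, integral_image_eq_integral_abs_det_fderiv_smul volume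
      measurableSet_unitSquare (fun z _ => (hasFDerivAt_conePoint P B C z).hasFDerivWithinAt)
      (injOn_conePoint h),
    setIntegral_congr_fun measurableSet_unitSquare (fun z hz => abs_det_mul_inv_dist h hz),
    unitSquare, Measure.volume_eq_prod,
    setIntegral_prod_mul (fun _ : ℝ => signedArea P B C) (fun t => 1 / segmentDist P B C t),
    ← integral_inv_dist_segment h.ne', intervalIntegral.integral_of_le zero_le_one,
    integral_Ioc_eq_integral_Ioo]
  simp

/-! ### Area coordinates in the solid triangle -/

theorem volume_signedArea_eq_zero {B C : Plane} (h : B ≠ C) :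
    volume {Q | signedArea B C Q = 0} = 0 := by
  have hsub : {Q | signedArea B C Q = 0} ⊆ affineSpan ℝ {B, C} := by
    intro Q hQ
    have hcol : Collinear ℝ {B, C, Q} := by
      by_contra hn
      exact signedArea_ne_zero (affineIndependent_iff_not_collinear_set.2 hn) hQ
    exact hcol.mem_affineSpan_of_mem_of_ne (by simp) (by simp) (by simp) h
  refine measure_mono_null hsub (Measure.addHaar_affineSubspace _ _ fun htop => ?_)
  have h1 := (collinear_pair ℝ B C).finrank_le_one
  rw [← direction_affineSpan, htop, AffineSubspace.direction_top, finrank_top,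
    finrank_euclideanSpace_fin] at h1
  omega

theorem mem_solidTriangle_iff {A B C : Plane} (h : 0 < signedArea A B C) (Q : Plane) :
    Q ∈ solidTriangle A B C ↔
      0 ≤ signedArea Q B C ∧ 0 ≤ signedArea A Q C ∧ 0 ≤ signedArea A B Q := by
  constructor
  · intro hQ
    refine convexHull_min (t := {Q | 0 ≤ signedArea Q B C ∧ 0 ≤ signedArea A Q C ∧
      0 ≤ signedArea A B Q}) ?_ ?_ hQ
    · rintro _ (rfl | rfl | rfl)
      · exact ⟨h.le, by simp [signedArea], by simp [signedArea, mul_comm]⟩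
      · exact ⟨by simp [signedArea], h.le, by simp [signedArea, mul_comm]⟩
      · exact ⟨by simp [signedArea, mul_comm], by simp [signedArea, mul_comm], h.le⟩
    · rintro x ⟨x1, x2, x3⟩ y ⟨y1, y2, y3⟩ s t hs ht hst
      obtain rfl : s = 1 - t := by linarith
      refine ⟨?_, ?_, ?_⟩
      · have : signedArea ((1 - t) • x + t • y) B C =
          (1 - t) * signedArea x B C + t * signedArea y B C := by simp [signedArea]; ring
        rw [this]; positivity
      · have : signedArea A ((1 - t) • x + t • y) C =
          (1 - t) * signedArea A x C + t * signedArea A y C := by simp [signedArea]; ring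
        rw [this]; positivity
      · have : signedArea A B ((1 - t) • x + t • y) =
          (1 - t) * signedArea A B x + t * signedArea A B y := by simp [signedArea]; ring
        rw [this]; positivity
  · rintro ⟨h1, h2, h3⟩
    have hsum : signedArea Q B C + signedArea A Q C + signedArea A B Q = signedArea A B C := by
      simp only [signedArea]; ring
    have hmem := (convex_convexHull ℝ {A, B, C}).sum_mem (t := Finset.univ)
      (w := ![signedArea Q B C / signedArea A B C, signedArea A Q C / signedArea A B C,
        signedArea A B Q / signedArea A B C]) (z := ![A, B, C])
      (by intro i _; fin_cases i <;> simp <;> positivity)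
      (by simp [Fin.sum_univ_three]; rw [← add_div, ← add_div, hsum, div_self h.ne'])
      (by intro i _; apply subset_convexHull; fin_cases i <;> simp)
    refine (congrArg (· ∈ solidTriangle A B C) ?_).mp hmem
    ext i
    fin_cases i <;> simp [Fin.sum_univ_three] <;> field_simp <;> simp only [signedArea] <;> ring

/-- A point in the interior of a set on which `f` is nonnegative can be pushed away from `V`
without leaving the set, which forces `f P > 0` if `f` is affine and `f V > 0`. -/
theorem pos_of_mem_interior {f : Plane → ℝ} {S : Set Plane} {P V : Plane}
    (hP : P ∈ interior S) (hS : ∀ Q ∈ S, 0 ≤ f Q) (hV : 0 < f V)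
    (hf : ∀ t : ℝ, f (P + t • (P - V)) = (1 + t) * f P - t * f V) : 0 < f P := by
  by_contra! hn
  have hc : ContinuousAt (fun t : ℝ => P + t • (P - V)) 0 := by fun_prop
  have hnear : ∀ᶠ t : ℝ in nhds 0, P + t • (P - V) ∈ S :=
    hc.eventually (by simpa using mem_interior_iff_mem_nhds.1 hP)
  obtain ⟨t, ht, ht0⟩ := ((hnear.filter_mono nhdsWithin_le_nhds).and
    (self_mem_nhdsWithin (s := Set.Ioi (0 : ℝ)))).exists
  have h1 := hS _ ht
  rw [hf] at h1
  have : 0 < t := ht0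
  nlinarith [mul_pos this hV]

theorem signedArea_pos_of_mem_interior {A B C P : Plane} (h : 0 < signedArea A B C)
    (hP : P ∈ interior (solidTriangle A B C)) :
    0 < signedArea P B C ∧ 0 < signedArea P C A ∧ 0 < signedArea P A B := by
  have hT (Q) (hQ : Q ∈ solidTriangle A B C) := (mem_solidTriangle_iff h Q).1 hQ
  have r1 (Q) : signedArea Q C A = signedArea A Q C := (signedArea_rotate A Q C).symm
  have r2 (Q) : signedArea Q A B = signedArea A B Q := signedArea_rotate Q A B
  refine ⟨pos_of_mem_interior (f := fun Q => signedArea Q B C) (V := A) hP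
      (fun Q hQ => (hT Q hQ).1) h ?_,
    pos_of_mem_interior (f := fun Q => signedArea Q C A) (V := B) hP
      (fun Q hQ => (r1 Q).symm ▸ (hT Q hQ).2.1) ((r1 B).symm ▸ h) ?_,
    pos_of_mem_interior (f := fun Q => signedArea Q A B) (V := C) hP
      (fun Q hQ => (r2 Q).symm ▸ (hT Q hQ).2.2) ((r2 C).symm ▸ h) ?_⟩ <;>
  · intro t
    simp [signedArea]
    ring

/-! ### Differentiating the contribution of one side -/

/-- The differential of the `i`-th Cartesian coordinate. -/
noncomputable def coordDeriv (i : Fin 2) : Plane →L[ℝ] ℝ := EuclideanSpace.proj i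

@[simp] theorem coordDeriv_apply (i : Fin 2) (v : Plane) : coordDeriv i v = v i := rfl

/-- The covector of the unit vector along `BP`, turned by a right angle. -/
noncomputable def rotatedUnit (P B : Plane) : Plane →L[ℝ] ℝ :=
  (dist P B)⁻¹ • ((P 1 - B 1) • coordDeriv 0 - (P 0 - B 0) • coordDeriv 1)

theorem hasFDerivAt_coord (i : Fin 2) (P : Plane) :
    HasFDerivAt (fun Q : Plane => Q i) (coordDeriv i) P :=
  (coordDeriv i).hasFDerivAt

theorem hasFDerivAt_dist {P B : Plane} (h : 0 < dist P B) :
    HasFDerivAt (fun Q => dist Q B)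
      ((dist P B)⁻¹ • ((P 0 - B 0) • coordDeriv 0 + (P 1 - B 1) • coordDeriv 1)) P := by
  have e (Q : Plane) : dist Q B = √((Q 0 - B 0) ^ 2 + (Q 1 - B 1) ^ 2) := by
    rw [← dist_sq_eq, Real.sqrt_sq dist_nonneg]
  have h0 : (P 0 - B 0) ^ 2 + (P 1 - B 1) ^ 2 ≠ 0 := by
    rw [← dist_sq_eq]; positivity
  have hd := ((((hasFDerivAt_coord 0 P).sub_const (B 0)).pow 2).add
    (((hasFDerivAt_coord 1 P).sub_const (B 1)).pow 2)).sqrt h0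
  simp only [funext e]
  refine hd.congr_fderiv ?_
  ext v
  simp only [e P]
  simp
  ring

/-- In the product rule for one term of the potential, the part in which the closed form
`sidePotential` is differentiated is a difference of two terms, each depending on a single
vertex; these cancel in the cyclic sum. -/
theorem hasFDerivAt_signedArea_mul_sidePotential {P B C : Plane} (h : signedArea P B C ≠ 0) :
    HasFDerivAt (fun Q => signedArea Q B C * sidePotential Q B C)
      (sidePotential P B C • ((B 1 - C 1) • coordDeriv 0 - (B 0 - C 0) • coordDeriv 1) +
        (rotatedUnit P B - rotatedUnit P C)) P := by
  have hb := dist_pos_of_signedArea_ne_zero h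
  have hc : 0 < dist P C := dist_pos_of_signedArea_ne_zero
    (by rw [signedArea_swap]; exact neg_ne_zero.2 h : signedArea P C B ≠ 0)
  have ha := dist_pos_of_signedArea_ne_zero (signedArea_rotate P B C ▸ h)
  have hS := dist_lt_dist_add_dist h
  have hin := dist_mul_dist_add_inner_pos h
  have hprod := dist_add_sq_sub P B C
  have hb2 := dist_sq_eq P B
  have hc2 := dist_sq_eq P C
  have hm : 0 < dist P B + dist P C - dist B C := by linarith
  have hp : 0 < dist P B + dist P C + dist B C := by linarith
  have d0 := hasFDerivAt_coord 0 P
  have d1 := hasFDerivAt_coord 1 P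
  have dA : HasFDerivAt (fun Q => signedArea Q B C)
      ((B 1 - C 1) • coordDeriv 0 - (B 0 - C 0) • coordDeriv 1) P := by
    refine (((d0.const_sub (B 0)).mul (d1.const_sub (C 1))).sub
      ((d1.const_sub (B 1)).mul (d0.const_sub (C 0)))).congr_fderiv ?_
    ext v
    simp
    ring
  have dB := hasFDerivAt_dist hb
  have dC := hasFDerivAt_dist hc
  set LB := (dist P B)⁻¹ • ((P 0 - B 0) • coordDeriv 0 + (P 1 - B 1) • coordDeriv 1) with hLB
  set LC := (dist P C)⁻¹ • ((P 0 - C 0) • coordDeriv 0 + (P 1 - C 1) • coordDeriv 1) with hLC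
  have dS : HasFDerivAt (fun Q => dist Q B + dist Q C) (LB + LC) P := dB.add dC
  have dK : HasFDerivAt (fun Q => sidePotential Q B C)
      (-(dist P B * dist P C + ((P 0 - B 0) * (P 0 - C 0) + (P 1 - B 1) * (P 1 - C 1)))⁻¹ •
        (LB + LC)) P := by
    have hlog := (((dS.sub_const (dist B C)).log hm.ne').sub
      ((dS.add_const (dist B C)).log hp.ne')).const_mul (-(dist B C)⁻¹)
    refine (hlog.congr_of_eventuallyEq ?_).congr_fderiv ?_
    · have hcont : Continuous fun Q => dist Q B + dist Q C := by fun_prop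
      filter_upwards [hcont.continuousAt.eventually (lt_mem_nhds hS)] with Q hQ
      have hQ' : 0 < dist Q B + dist Q C + dist B C := by linarith
      have hQ'' : dist Q B + dist Q C - dist B C ≠ 0 := by linarith
      simp only [sidePotential, sideRatio, Pi.sub_apply]
      rw [Real.log_div hQ'' hQ'.ne']
      ring
    · rw [← sub_smul, smul_smul]
      congr 1
      field_simp
      linear_combination dist B C * hprod
  refine (dA.mul dK).congr_fderiv ?_
  rw [hLB, hLC, rotatedUnit, rotatedUnit]
  have key0 : signedArea P B C * ((P 0 - B 0) * dist P C + (P 0 - C 0) * dist P B) =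
      -((P 1 - B 1) * dist P C - (P 1 - C 1) * dist P B) * (dist P B * dist P C +
        ((P 0 - B 0) * (P 0 - C 0) + (P 1 - B 1) * (P 1 - C 1))) := by
    unfold signedArea
    linear_combination -(dist P C * (P 1 - C 1)) * hb2 + dist P B * (P 1 - B 1) * hc2
  have key1 : signedArea P B C * ((P 1 - B 1) * dist P C + (P 1 - C 1) * dist P B) =
      ((P 0 - B 0) * dist P C - (P 0 - C 0) * dist P B) * (dist P B * dist P C +
        ((P 0 - B 0) * (P 0 - C 0) + (P 1 - B 1) * (P 1 - C 1))) := by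
    unfold signedArea
    linear_combination dist P C * (P 0 - C 0) * hb2 - dist P B * (P 0 - B 0) * hc2
  set m := dist P B * dist P C + ((P 0 - B 0) * (P 0 - C 0) + (P 1 - B 1) * (P 1 - C 1))
  clear_value m
  ext v
  simp
  field_simp
  linear_combination -v 0 * key0 - v 1 * key1

/-! ### The potential and the field inside the triangle -/

/-- Up to a null set, the segments from an inner point `P` to the vertices cut the triangle
`ABC` into the triangles `PBC`, `PCA` and `PAB`. -/
theorem solidTriangle_ae_eq {A B C P : Plane} (h : 0 < signedArea A B C)
    (hA : 0 < signedArea P B C) (hB : 0 < signedArea P C A) (hC : 0 < signedArea P A B) :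
    solidTriangle A B C =ᵐ[volume]
      (openTriangle P B C ∪ (openTriangle P C A ∪ openTriangle P A B) : Set Plane) := by
  have off {X Y : Plane} (hXY : 0 < dist X Y) : ∀ᵐ Q, signedArea X Y Q ≠ 0 := by
    rw [ae_iff]
    simpa using volume_signedArea_eq_zero (dist_pos.1 hXY)
  refine Filter.eventuallyEq_set.2 ?_
  filter_upwards [off (dist_pos_of_signedArea_ne_zero hC.ne'),
    off (dist_pos_of_signedArea_ne_zero hA.ne'), off (dist_pos_of_signedArea_ne_zero hB.ne'),
    off (dist_pos_of_signedArea_ne_zero (signedArea_rotate P B C ▸ hA.ne')),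
    off (dist_pos_of_signedArea_ne_zero (signedArea_rotate P C A ▸ hB.ne')),
    off (dist_pos_of_signedArea_ne_zero (signedArea_rotate P A B ▸ hC.ne'))]
    with Q xA xB xC yA yB yC
  rw [← signedArea_rotate] at yA yB yC
  rw [mem_solidTriangle_iff h, signedArea_rotate A Q C, ← signedArea_rotate Q A B]
  have sA : signedArea P Q A = -signedArea P A Q := signedArea_swap _ _ _
  have sB : signedArea P Q B = -signedArea P B Q := signedArea_swap _ _ _
  have sC : signedArea P Q C = -signedArea P C Q := signedArea_swap _ _ _
  -- the barycentric coordinates of `P` annihilate the three areas spanned with `P` and `Q`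
  have hlin : signedArea P B C * signedArea P A Q + signedArea P C A * signedArea P B Q +
      signedArea P A B * signedArea P C Q = 0 := by
    simp only [signedArea]; ring
  simp only [openTriangle, Set.mem_union, Set.mem_ofPred_eq, sA, sB, sC]
  constructor
  · rintro ⟨h1, h2, h3⟩
    have h1 := h1.lt_of_ne' yA
    have h2 := h2.lt_of_ne' yB
    have h3 := h3.lt_of_ne' yC
    rcases xA.lt_or_gt with a | a <;> rcases xB.lt_or_gt with b | b <;>
      rcases xC.lt_or_gt with c | c
    · linarith [mul_neg_of_pos_of_neg hA a, mul_neg_of_pos_of_neg hB b,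
        mul_neg_of_pos_of_neg hC c]
    · exact Or.inr (Or.inl ⟨h2, by linarith, c⟩)
    · exact Or.inl ⟨h1, by linarith, b⟩
    · exact Or.inr (Or.inl ⟨h2, by linarith, c⟩)
    · exact Or.inr (Or.inr ⟨h3, by linarith, a⟩)
    · exact Or.inr (Or.inr ⟨h3, by linarith, a⟩)
    · exact Or.inl ⟨h1, by linarith, b⟩
    · linarith [mul_pos hA a, mul_pos hB b, mul_pos hC c]
  · have aux {X Y Z : Plane} (hX : 0 < signedArea P Y Z) (hY : 0 < signedArea P Z X)
        (hZ : 0 < signedArea P X Y) (h1 : 0 < signedArea Q Y Z) (h2 : 0 < -signedArea P Z Q)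
        (h3 : 0 < signedArea P Y Q) : 0 ≤ signedArea Q Z X ∧ 0 ≤ signedArea Q X Y := by
      have hs : 0 < signedArea X Y Z := by
        have : signedArea X Y Z = signedArea P Y Z + signedArea P Z X + signedArea P X Y := by
          simp only [signedArea]; ring
        rw [this]; positivity
      have e1 : signedArea P Y Z * signedArea Q Z X = signedArea Q Y Z * signedArea P Z X +
          -signedArea P Z Q * signedArea X Y Z := by
        simp only [signedArea]; ring
      have e2 : signedArea P Y Z * signedArea Q X Y = signedArea Q Y Z * signedArea P X Y +
          signedArea P Y Q * signedArea X Y Z := by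
        simp only [signedArea]; ring
      constructor
      · refine (pos_of_mul_pos_right ?_ hX.le).le
        rw [e1]; positivity
      · refine (pos_of_mul_pos_right ?_ hX.le).le
        rw [e2]; positivity
    rintro (⟨h1, h2, h3⟩ | ⟨h1, h2, h3⟩ | ⟨h1, h2, h3⟩)
    · exact ⟨h1.le, aux hA hB hC h1 h2 h3⟩
    · obtain ⟨k1, k2⟩ := aux hB hC hA h1 h2 h3
      exact ⟨k2, h1.le, k1⟩
    · obtain ⟨k1, k2⟩ := aux hC hA hB h1 h2 h3
      exact ⟨k1, k2, h1.le⟩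

theorem disjoint_openTriangle (P X Y Z : Plane) :
    Disjoint (openTriangle P X Y) (openTriangle P Y Z) := by
  refine Set.disjoint_left.2 ?_
  rintro Q ⟨-, h, -⟩ ⟨-, -, h'⟩
  rw [signedArea_swap] at h
  linarith

theorem potential_eq {A B C P : Plane} (h : 0 < signedArea A B C)
    (hP : P ∈ interior (solidTriangle A B C)) :
    potential A B C P = signedArea P B C * sidePotential P B C +
      (signedArea P C A * sidePotential P C A + signedArea P A B * sidePotential P A B) := by
  obtain ⟨hA, hB, hC⟩ := signedArea_pos_of_mem_interior h hP
  rw [potential, setIntegral_congr_set (solidTriangle_ae_eq h hA hB hC),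
    setIntegral_union _ ((isOpen_openTriangle _ _ _).union (isOpen_openTriangle _ _ _)).measurableSet
      (integrableOn_openTriangle hA)
      ((integrableOn_openTriangle hB).union (integrableOn_openTriangle hC)),
    setIntegral_union (disjoint_openTriangle _ _ _ _) (isOpen_openTriangle _ _ _).measurableSet
      (integrableOn_openTriangle hB) (integrableOn_openTriangle hC),
    setIntegral_openTriangle hA, setIntegral_openTriangle hB, setIntegral_openTriangle hC]
  exact Set.disjoint_union_right.2
    ⟨disjoint_openTriangle _ _ _ _, (disjoint_openTriangle _ _ _ _).symm⟩

/-- The potential is differentiable inside the triangle, and its differential is a combination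
of the normal covectors of the three sides, weighted by the side potentials. -/
theorem hasFDerivAt_potential {A B C P : Plane} (h : 0 < signedArea A B C)
    (hP : P ∈ interior (solidTriangle A B C)) :
    HasFDerivAt (potential A B C)
      (sidePotential P B C • ((B 1 - C 1) • coordDeriv 0 - (B 0 - C 0) • coordDeriv 1) +
        (sidePotential P C A • ((C 1 - A 1) • coordDeriv 0 - (C 0 - A 0) • coordDeriv 1) +
          sidePotential P A B • ((A 1 - B 1) • coordDeriv 0 - (A 0 - B 0) • coordDeriv 1))) P := by
  obtain ⟨hA, hB, hC⟩ := signedArea_pos_of_mem_interior h hP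
  have hsum := (hasFDerivAt_signedArea_mul_sidePotential hA.ne').add
    ((hasFDerivAt_signedArea_mul_sidePotential hB.ne').add
      (hasFDerivAt_signedArea_mul_sidePotential hC.ne'))
  refine (hsum.congr_of_eventuallyEq ?_).congr_fderiv (by abel)
  filter_upwards [isOpen_interior.mem_nhds hP] with Q hQ using potential_eq h hQ

/-- At a zero of the field the three side potentials agree, because up to scaling the normals
of the sides of a triangle satisfy only one linear relation. -/
theorem sidePotential_eq_of_field_eq_zero {A B C P : Plane} (h : 0 < signedArea A B C)
    (hP : P ∈ interior (solidTriangle A B C)) (hE : field A B C P = 0) :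
    sidePotential P B C = sidePotential P C A ∧ sidePotential P C A = sidePotential P A B := by
  have hd : fderiv ℝ (potential A B C) P = 0 := by
    simpa [field, gradient] using hE
  rw [(hasFDerivAt_potential h hP).fderiv] at hd
  have h0 := DFunLike.congr_fun hd (EuclideanSpace.single 0 1)
  have h1 := DFunLike.congr_fun hd (EuclideanSpace.single 1 1)
  simp at h0 h1
  constructor
  · refine sub_eq_zero.1 ((mul_eq_zero.1 ?_).resolve_right h.ne')
    simp only [signedArea]
    linear_combination (A 0 - B 0) * h0 + (A 1 - B 1) * h1
  · refine sub_eq_zero.1 ((mul_eq_zero.1 ?_).resolve_right h.ne')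
    simp only [signedArea]
    linear_combination (B 0 - C 0) * h0 + (B 1 - C 1) * h1

theorem solidTriangle_swap (A B C : Plane) : solidTriangle A B C = solidTriangle A C B := by
  rw [solidTriangle, solidTriangle, Set.pair_comm]

theorem field_swap (A B C : Plane) : field A B C = field A C B := by
  unfold field
  have : potential A B C = potential A C B := by
    funext P
    rw [potential, potential, solidTriangle_swap]
  rw [this]

theorem theorem1 (A B C P : Plane)
    (hABC : AffineIndependent ℝ ![A, B, C])
    (hP : P ∈ interior (solidTriangle A B C))
    (hE : field A B C P = 0) :
    (((dist P B + dist P C - dist B C) / (dist P B + dist P C + dist B C)) ^ (1 / dist B C)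
        = ((dist P C + dist P A - dist C A) / (dist P C + dist P A + dist C A)) ^ (1 / dist C A) ∧
      ((dist P C + dist P A - dist C A) / (dist P C + dist P A + dist C A)) ^ (1 / dist C A)
        = ((dist P A + dist P B - dist A B) / (dist P A + dist P B + dist A B)) ^ (1 / dist A B)) ∧
    ((Real.tan (∠ C B P / 2) * Real.tan (∠ P C B / 2)) ^ (1 / Real.sin (∠ B A C))
        = (Real.tan (∠ A C P / 2) * Real.tan (∠ P A C / 2)) ^ (1 / Real.sin (∠ C B A)) ∧
      (Real.tan (∠ A C P / 2) * Real.tan (∠ P A C / 2)) ^ (1 / Real.sin (∠ C B A))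
        = (Real.tan (∠ B A P / 2) * Real.tan (∠ P B A / 2)) ^ (1 / Real.sin (∠ A C B))) := by
  rcases (signedArea_ne_zero hABC).lt_or_gt with h | h
  · -- a clockwise triangle becomes counterclockwise when two vertices are exchanged
    have h' : 0 < signedArea A C B := by rw [signedArea_swap]; linarith
    rw [solidTriangle_swap] at hP
    rw [field_swap] at hE
    obtain ⟨hA, hB, hC⟩ := signedArea_pos_of_mem_interior h' hP
    obtain ⟨e1, e2⟩ := sidePotential_eq_of_field_eq_zero h' hP hE
    rw [sidePotential_comm P C B, sidePotential_comm P B A] at e1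
    rw [sidePotential_comm P B A, sidePotential_comm P A C] at e2
    refine equalities_of_sidePotential_eq hABC ?_ ?_ ?_ (e1.trans e2) e2.symm <;>
    · rw [signedArea_swap]
      linarith
  · obtain ⟨hA, hB, hC⟩ := signedArea_pos_of_mem_interior h hP
    obtain ⟨e1, e2⟩ := sidePotential_eq_of_field_eq_zero h hP hE
    exact equalities_of_sidePotential_eq hABC hA.ne' hB.ne' hC.ne' e1 e2
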